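/- Let $P\subset\mathbb{R}^3$ be a $3$-dimensional smooth lattice polytope: its vertices lie in $\mathbb{Z}^3$, exactly three edges meet at each vertex, the edge directions are rational, and the primitive edge-direction vectors at each vertex form a basis of the lattice $\mathbb{Z}^3$. Assume that the origin is in the interior of $P$ and is next to some edge $e$ of $P$; that is, writing each facet of $P$ containing $e$ as $\{x\in P : u\cdot x=b\}$, where $u\in\mathbb{Z}^3$ is primitive and $u\cdot x\le b$ is valid on $P$, the maximum of the lattice distances $|b-u\cdot 0|$ from the origin to these facets is $1$. (Equivalently, the origin lies in the interior of $P$ and in the first displacement of $e$, the set of points $x\in P$ with $u\cdot x=b-1$ for each of these facets.) Then the Ewald set $\mathcal{E}(P)=\mathbb{Z}^3\cap P\cap(-P)$ contains a lattice basis of $\mathbb{Z}^3$. -/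

import Mathlib

/-- The inclusion of the lattice `ℤⁿ` in `ℝⁿ`. -/
def toReal {n : ℕ} (z : Fin n → ℤ) : Fin n → ℝ := fun i => (z i : ℝ)

/-- A primitive lattice vector: its coordinates have greatest common divisor `1`. -/
def IsPrimitiveVector {n : ℕ} (z : Fin n → ℤ) : Prop :=
  Finset.univ.gcd z = 1

/-- A polytope: the convex hull of a finite set of points. -/
def IsPolytope {n : ℕ} (P : Set (Fin n → ℝ)) : Prop :=
  ∃ S : Set (Fin n → ℝ), S.Finite ∧ P = convexHull ℝ S

/-- A lattice polytope: a polytope all of whose vertices are in `ℤⁿ`. -/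
def IsLatticePolytope {n : ℕ} (P : Set (Fin n → ℝ)) : Prop :=
  IsPolytope P ∧ ∀ v ∈ P.extremePoints ℝ, ∃ z : Fin n → ℤ, v = toReal z

/-- The dimension of (the affine span of) a nonempty subset of `ℝⁿ`. -/
noncomputable def polyDim {n : ℕ} (F : Set (Fin n → ℝ)) : ℕ :=
  Module.finrank ℝ (vectorSpan ℝ F)

/-- The `d`-dimensional faces of `P`: the nonempty sets of maximizers in `P` of a linear functional,
of dimension `d`. -/
def IsFaceOfDim {n : ℕ} (P : Set (Fin n → ℝ)) (d : ℕ) (F : Set (Fin n → ℝ)) : Prop :=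
  F.Nonempty ∧ IsExposed ℝ P F ∧ polyDim F = d

/-- Edges are the faces of dimension one. -/
def IsEdge {n : ℕ} (P e : Set (Fin n → ℝ)) : Prop :=
  IsFaceOfDim P 1 e

/-- `F` is a facet of `P ⊆ ℝⁿ` (a face of dimension `n - 1`), with primitive facet inequality
`u · x ≤ b`. -/
def IsFacetInequality {n : ℕ} (P F : Set (Fin n → ℝ)) (u : Fin n → ℤ) (b : ℝ) : Prop :=
  (∃ d : ℕ, d + 1 = n ∧ IsFaceOfDim P d F) ∧ IsPrimitiveVector u ∧
    (∀ x ∈ P, toReal u ⬝ᵥ x ≤ b) ∧ F = {x ∈ P | toReal u ⬝ᵥ x = b}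

/-- The primitive edge-direction vectors of `P` at its vertex `v`, pointing away from `v`. -/
def primitiveEdgeVectors {n : ℕ} (P : Set (Fin n → ℝ)) (v : Fin n → ℝ) : Set (Fin n → ℤ) :=
  {w | IsPrimitiveVector w ∧ ∃ e, IsEdge P e ∧ v ∈ e ∧ ∃ t : ℝ, 0 < t ∧ v + t • toReal w ∈ e}

/-- A smooth `n`-dimensional polytope in `ℝⁿ`: it is simple, it has rational edge directions, and
at each vertex the primitive edge-direction vectors form a basis of the lattice `ℤⁿ`. -/
structure IsSmoothPolytope {n : ℕ} (P : Set (Fin n → ℝ)) : Prop where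
  isPolytope : IsPolytope P
  nonempty : P.Nonempty
  fullDim : polyDim P = n
  simple : ∀ v ∈ P.extremePoints ℝ, {e | IsEdge P e ∧ v ∈ e}.encard = n
  rational : ∀ e, IsEdge P e → ∃ w : Fin n → ℤ, w ≠ 0 ∧ toReal w ∈ vectorSpan ℝ e
  unimodular : ∀ v ∈ P.extremePoints ℝ,
    ∃ B : Module.Basis (Fin n) ℤ (Fin n → ℤ), Set.range B = primitiveEdgeVectors P v

/-- `δ` is the lattice distance from `x₀` to the face `F` of `P`: the maximum of the lattice
distances `|b - u · x₀|` from `x₀` to the facets of `P` that contain `F`. -/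
def IsDistanceToFace {n : ℕ} (P F : Set (Fin n → ℝ)) (x₀ : Fin n → ℝ) (δ : ℝ) : Prop :=
  IsGreatest {r : ℝ | ∃ G u b, IsFacetInequality P G u b ∧ F ⊆ G ∧ r = |b - toReal u ⬝ᵥ x₀|} δ

/-- `x₀` is next to the face `F` of `P`: it is in the interior of `P` and at distance one
from `F`. -/
def IsNextTo {n : ℕ} (P F : Set (Fin n → ℝ)) (x₀ : Fin n → ℝ) : Prop :=
  x₀ ∈ interior P ∧ IsDistanceToFace P F x₀ 1

/-- The Ewald set `ℤⁿ ∩ P ∩ -P`, as a subset of `ℤⁿ`. -/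
def ewaldSet {n : ℕ} (P : Set (Fin n → ℝ)) : Set (Fin n → ℤ) :=
  {z | toReal z ∈ P ∧ -toReal z ∈ P}

/-!
The proof works with the lattice points of `P` in the coordinates of a vertex `v` of `e`: its edge
vectors `w₁, w₂, w₃` form a lattice basis, with `w₃` in the direction of `e`, and by hypothesis
the origin is `v + w₁ + w₂ + c₀ w₃`. Write `(a, b, c)` for `v + a w₁ + b w₂ + c w₃`.

The points `(1, 0, c)` and `(0, 1, c)` of `P` form lattice segments, starting at `c = 0`. Suppose
that `P` contains the neighbours `(1, 1, c₀ ± 1)` of the origin and a point `(1, 2, r)` with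
`(1, 0, 2 c₀ - r)`, which is its negative, in the first of these segments. Together with the analogous
point `(2, 1, r')` this gives three pairs of opposite lattice points, and they contain a basis. By
convexity, `r` exists as soon as there is one lattice point `(1, 2, l)` low enough (`l ≤ 2 c₀`)
and another one high enough; the two requirements are exchanged by passing to the other end of
`e`.

Low points come from smoothness (`IsVertexSystem.exists_low_point`). The facet `c = 0` contains
`(1, 1, 0)` unless it is a unimodular triangle. If it ends before `(1, 2, 0)`, the facet that
follows it rises slowly, since the edge vectors at their common vertices form a lattice basis, so
it or its surroundings contain a point `(1, 2, l)` with `l ≤ 2`. If `c = 0` is a triangle, then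
either `c₀ ≥ 2`, and the argument still applies, if necessary at the virtual vertex obtained by
pushing the triangle outwards until it disappears; or `c₀ = 1`, and then the points at height one
form a triangle containing the reflections of `w₁` and `w₂`, while `w₁ + w₂ + w₃ = -v` is a point
of `P` since the three edges leaving the triangle go far enough
(`IsVertexSystem.two_two_two_mem`).

The facts about polytopes used here are the axioms of `IsVertexSystem`. The essential one is that
`P` lies in the cone spanned by its edges at a vertex (`IsLatticePolytope.le_of_edgeVectors`).
-/

/-! ### Lattice points of smooth polytopes in dimension three -/

/-- The combinatorial skeleton of a smooth lattice polytope in `ℝ³`, seen from its lattice points.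
`M` is the set of lattice points, `o` an interior lattice point, and `Star v w₁ w₂ w₃` says that `v`
is a vertex whose primitive edge vectors are `w₁, w₂, w₃`, in any order. Everything is phrased by
lattice points: convexity as barycentric combinations with integer weights, and interiority of `o`
as the statement that no nonzero integral functional attains its maximum over `M` at `o`. -/
structure IsVertexSystem (M : Set (Fin 3 → ℤ)) (o : Fin 3 → ℤ)
    (Star : (Fin 3 → ℤ) → (Fin 3 → ℤ) → (Fin 3 → ℤ) → (Fin 3 → ℤ) → Prop) : Prop where
  convex : ∀ {x y z p : Fin 3 → ℤ} {a b c : ℤ}, x ∈ M → y ∈ M → z ∈ M → 0 ≤ a → 0 ≤ b → 0 ≤ c →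
    0 < a + b + c → (a + b + c) • p = a • x + b • y + c • z → p ∈ M
  interior : ∀ f : (Fin 3 → ℤ) →ₗ[ℤ] ℤ, f ≠ 0 → ∃ x ∈ M, f o < f x
  swap : ∀ {v w₁ w₂ w₃}, Star v w₁ w₂ w₃ → Star v w₂ w₁ w₃
  rotate : ∀ {v w₁ w₂ w₃}, Star v w₁ w₂ w₃ → Star v w₂ w₃ w₁
  basis : ∀ {v w₁ w₂ w₃}, Star v w₁ w₂ w₃ →
    ∃ B : Module.Basis (Fin 3) ℤ (Fin 3 → ℤ), B 0 = w₁ ∧ B 1 = w₂ ∧ B 2 = w₃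
  vertex_mem : ∀ {v w₁ w₂ w₃}, Star v w₁ w₂ w₃ → v ∈ M
  cone : ∀ {v w₁ w₂ w₃ x}, Star v w₁ w₂ w₃ → x ∈ M →
    ∃ a b c : ℤ, 0 ≤ a ∧ 0 ≤ b ∧ 0 ≤ c ∧ x = v + a • w₁ + b • w₂ + c • w₃
  edge : ∀ {v w₁ w₂ w₃}, Star v w₁ w₂ w₃ →
    ∃ (t : ℤ) (p q : Fin 3 → ℤ), 1 ≤ t ∧ Star (v + t • w₁) (-w₁) p q

namespace IsVertexSystem

variable {M : Set (Fin 3 → ℤ)} {o : Fin 3 → ℤ}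
  {Star : (Fin 3 → ℤ) → (Fin 3 → ℤ) → (Fin 3 → ℤ) → (Fin 3 → ℤ) → Prop}
  {v w₁ w₂ w₃ : Fin 3 → ℤ}

theorem triangle (h : IsVertexSystem M o Star) {x p q : Fin 3 → ℤ} {n i j : ℤ} (hx : x ∈ M)
    (hp : x + n • p ∈ M) (hq : x + n • q ∈ M) (hi : 0 ≤ i) (hj : 0 ≤ j) (hij : i + j ≤ n) :
    x + i • p + j • q ∈ M := by
  rcases (by lia : n = 0 ∨ 0 < n) with rfl | hn
  · obtain rfl : i = 0 := by lia
    obtain rfl : j = 0 := by lia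
    simpa using hx
  · refine h.convex (a := n - i - j) (b := i) (c := j) hx hp hq (by lia) hi hj (by lia) ?_
    module

theorem segment (h : IsVertexSystem M o Star) {x p : Fin 3 → ℤ} {n i : ℤ} (hx : x ∈ M)
    (hp : x + n • p ∈ M) (hi : 0 ≤ i) (hin : i ≤ n) : x + i • p ∈ M := by
  simpa using h.triangle (q := 0) (j := 0) hx hp (by simpa using hx) hi le_rfl (by lia)

theorem coord_unique (h : IsVertexSystem M o Star) (hv : Star v w₁ w₂ w₃) {a b c a' b' c' : ℤ}
    (he : a • w₁ + b • w₂ + c • w₃ = a' • w₁ + b' • w₂ + c' • w₃) : a = a' ∧ b = b' ∧ c = c' := by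
  obtain ⟨B, rfl, rfl, rfl⟩ := h.basis hv
  have h0 := congrArg (fun x => B.repr x 0) he
  have h1 := congrArg (fun x => B.repr x 1) he
  have h2 := congrArg (fun x => B.repr x 2) he
  simp only [map_add, map_smul, Module.Basis.repr_self, Finsupp.coe_add, Finsupp.coe_smul,
    Pi.add_apply, Pi.smul_apply, Finsupp.single_apply] at h0 h1 h2
  simp at h0 h1 h2
  exact ⟨h0, h1, h2⟩

theorem coord_exists (h : IsVertexSystem M o Star) (hv : Star v w₁ w₂ w₃) (x : Fin 3 → ℤ) :
    ∃ a b c : ℤ, x = a • w₁ + b • w₂ + c • w₃ := by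
  obtain ⟨B, rfl, rfl, rfl⟩ := h.basis hv
  refine ⟨B.repr x 0, B.repr x 1, B.repr x 2, ?_⟩
  conv_lhs => rw [← B.sum_repr x, Fin.sum_univ_three]

theorem coord_nonneg (h : IsVertexSystem M o Star) (hv : Star v w₁ w₂ w₃) {a b c : ℤ}
    (hx : v + a • w₁ + b • w₂ + c • w₃ ∈ M) : 0 ≤ a ∧ 0 ≤ b ∧ 0 ≤ c := by
  obtain ⟨a', b', c', ha, hb, hc, he⟩ := h.cone hv hx
  obtain ⟨rfl, rfl, rfl⟩ := h.coord_unique hv (a := a) (b := b) (c := c) (a' := a') (b' := b')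
    (c' := c') (by simpa [add_assoc] using he)
  exact ⟨ha, hb, hc⟩

theorem add_edge_mem (h : IsVertexSystem M o Star) (hv : Star v w₁ w₂ w₃) : v + w₁ ∈ M := by
  obtain ⟨t, p, q, ht, hs⟩ := h.edge hv
  simpa using h.segment (i := 1) (h.vertex_mem hv) (h.vertex_mem hs) (by lia) ht

/-- Interiority of `o` in the coordinates of a vertex: inequalities valid on `M` are strict
at `o`. -/
theorem coord_lt (h : IsVertexSystem M o Star) (hv : Star v w₁ w₂ w₃) {a₀ b₀ c₀ l m n d : ℤ}
    (ho : o = v + a₀ • w₁ + b₀ • w₂ + c₀ • w₃) (hlmn : l ≠ 0 ∨ m ≠ 0 ∨ n ≠ 0)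
    (hd : ∀ a b c : ℤ, v + a • w₁ + b • w₂ + c • w₃ ∈ M → l * a + m * b + n * c ≤ d) :
    l * a₀ + m * b₀ + n * c₀ < d := by
  obtain ⟨B, rfl, rfl, rfl⟩ := h.basis hv
  let f : (Fin 3 → ℤ) →ₗ[ℤ] ℤ := l • B.coord 0 + m • B.coord 1 + n • B.coord 2
  have hf0 : f (B 0) = l := by simp [f]
  have hf1 : f (B 1) = m := by simp [f]
  have hf2 : f (B 2) = n := by simp [f]
  have hfne : f ≠ 0 := by
    intro h0
    simp only [h0, LinearMap.zero_apply] at hf0 hf1 hf2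
    lia
  obtain ⟨x, hx, hlt⟩ := h.interior f hfne
  obtain ⟨a, b, c, -, -, -, rfl⟩ := h.cone hv hx
  have := hd a b c hx
  rw [ho] at hlt
  simp only [map_add, map_smul, hf0, hf1, hf2, smul_eq_mul] at hlt
  linarith

/-- Passing to the other end of an edge keeps the two facets through that edge, so in suitable order
the two other edge vectors change only by multiples of the edge vector. -/
theorem move (h : IsVertexSystem M o Star) (hv : Star v w₁ w₂ w₃) :
    ∃ t i j : ℤ, 1 ≤ t ∧ Star (v + t • w₁) (-w₁) (w₂ + i • w₁) (w₃ + j • w₁) := by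
  obtain ⟨t, p, q, ht, hs⟩ := h.edge hv
  obtain ⟨p₁, p₂, p₃, rfl⟩ := h.coord_exists hv p
  obtain ⟨q₁, q₂, q₃, rfl⟩ := h.coord_exists hv q
  have hp := h.add_edge_mem (h.rotate hs)
  have hq := h.add_edge_mem (h.rotate (h.rotate hs))
  obtain ⟨-, hp₂, hp₃⟩ := h.coord_nonneg hv (a := t + p₁) (b := p₂) (c := p₃)
    (by convert hp using 1; module)
  obtain ⟨-, hq₂, hq₃⟩ := h.coord_nonneg hv (a := t + q₁) (b := q₂) (c := q₃)
    (by convert hq using 1; module)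
  obtain ⟨a, b, c, ha, hb, hc, he⟩ := h.cone hs (h.add_edge_mem (h.rotate hv))
  obtain ⟨a', b', c', ha', hb', hc', he'⟩ := h.cone hs (h.add_edge_mem (h.rotate (h.rotate hv)))
  obtain ⟨-, e₂, e₃⟩ := h.coord_unique hv (a := 0) (b := 1) (c := 0)
    (a' := t - a + b * p₁ + c * q₁) (b' := b * p₂ + c * q₂) (c' := b * p₃ + c * q₃) (by
      have : w₂ = (v + w₂) - v := by module
      rw [he] at this
      linear_combination (exp := 1) this)
  obtain ⟨-, e₂', e₃'⟩ := h.coord_unique hv (a := 0) (b := 0) (c := 1)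
    (a' := t - a' + b' * p₁ + c' * q₁) (b' := b' * p₂ + c' * q₂) (c' := b' * p₃ + c' * q₃) (by
      have : w₃ = (v + w₃) - v := by module
      rw [he'] at this
      linear_combination (exp := 1) this)
  -- Modulo `w₁`, the cone of the new edge vectors lies in the quadrant of `w₂, w₃` and contains
  -- `w₂` and `w₃`, so its generators are `w₂` and `w₃`.
  have nonneg_of_sum : ∀ x y x' y' : ℤ, 0 ≤ x → 0 ≤ y → 0 ≤ x' → 0 ≤ y' →
      x * y + x' * y' = 1 → (x = 1 ∧ y = 1) ∨ (x' = 1 ∧ y' = 1) := by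
    intro x y x' y' hx hy hx' hy' hxy
    have h1 := mul_nonneg hx hy
    have h2 := mul_nonneg hx' hy'
    rcases (by lia : x * y = 1 ∨ x' * y' = 1) with h3 | h3
    · rcases Int.mul_eq_one_iff_eq_one_or_neg_one.mp h3 with h4 | h4
      · exact Or.inl h4
      · lia
    · rcases Int.mul_eq_one_iff_eq_one_or_neg_one.mp h3 with h4 | h4
      · exact Or.inr h4
      · lia
  rcases nonneg_of_sum b p₂ c q₂ hb hp₂ hc hq₂ e₂.symm with ⟨rfl, rfl⟩ | ⟨rfl, rfl⟩
  · have h1 : 0 ≤ c * q₃ := mul_nonneg hc hq₃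
    obtain rfl : p₃ = 0 := by lia
    rcases nonneg_of_sum b' 0 c' q₃ hb' le_rfl hc' hq₃ e₃'.symm with ⟨_, h2⟩ | ⟨rfl, rfl⟩
    · lia
    obtain rfl : q₂ = 0 := by lia
    refine ⟨t, p₁, q₁, ht, ?_⟩
    convert hs using 1 <;> module
  · have h1 : 0 ≤ b * p₃ := mul_nonneg hb hp₃
    obtain rfl : q₃ = 0 := by lia
    rcases nonneg_of_sum b' p₃ c' 0 hb' hp₃ hc' le_rfl e₃'.symm with ⟨rfl, rfl⟩ | ⟨_, h2⟩
    · obtain rfl : p₂ = 0 := by lia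
      refine ⟨t, q₁, p₁, ht, ?_⟩
      convert h.rotate (h.swap hs) using 1 <;> module
    · lia

/-- A two-dimensional face at the vertex `v`, with edge vectors `w₁, w₂`, contains `v + w₁ + w₂`
unless it is a unimodular triangle. In the second case the vertices `v + w₁` and `v + w₂` have edge
vectors with the same `z`, because the facet beyond the edge joining them contains both third
edges. -/
theorem square_or_triangle (h : IsVertexSystem M o Star) (hv : Star v w₁ w₂ w₃) :
    v + w₁ + w₂ ∈ M ∨ ∃ z : ℤ, Star (v + w₂) (-w₂) (w₁ - w₂) (w₃ + z • w₂) ∧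
      Star (v + w₁) (-w₁) (w₂ - w₁) (w₃ + z • w₁) := by
  by_cases hsq : v + w₁ + w₂ ∈ M
  · exact Or.inl hsq
  right
  obtain ⟨t₂, i₂, z₂, ht₂, hs₂⟩ := h.move (h.swap hv)
  obtain ⟨t₁, i₁, z₁, ht₁, hs₁⟩ := h.move hv
  -- The edge of the face that follows `w₂` passes through `v + w₁ + (t₂ + i₂) • w₂`. If `t₂ + i₂`
  -- were positive, then `v + w₁ + w₂` would lie between that point and `v + w₁`.
  have hi₂ : t₂ + i₂ ≤ 0 := by
    by_contra hlt
    have := h.segment (x := v + w₁) (p := w₂) (n := t₂ + i₂) (i := 1) (h.add_edge_mem hv)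
      (by convert h.add_edge_mem (h.rotate hs₂) using 1; module) (by lia) (by lia)
    exact hsq (by convert this using 1; module)
  have hi₁ : t₁ + i₁ ≤ 0 := by
    by_contra hlt
    have := h.segment (x := v + w₂) (p := w₁) (n := t₁ + i₁) (i := 1)
      (h.add_edge_mem (h.swap hv))
      (by convert h.add_edge_mem (h.rotate hs₁) using 1; module) (by lia) (by lia)
    exact hsq (by convert this using 1; module)
  have key₂ : ∀ a b c : ℤ, v + a • w₁ + b • w₂ + c • w₃ ∈ M → b ≤ t₂ + i₂ * a + z₂ * c := by
    intro a b c hm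
    have := h.coord_nonneg hs₂ (a := t₂ + i₂ * a + z₂ * c - b) (b := a) (c := c)
      (by convert hm using 1; module)
    lia
  have key₁ : ∀ a b c : ℤ, v + a • w₁ + b • w₂ + c • w₃ ∈ M → a ≤ t₁ + i₁ * b + z₁ * c := by
    intro a b c hm
    have := h.coord_nonneg hs₁ (a := t₁ + i₁ * b + z₁ * c - a) (b := b) (c := c)
      (by convert hm using 1; module)
    lia
  have c₁ := key₂ 1 0 0 (by simpa using h.add_edge_mem hv)
  have c₂ := key₁ 0 1 0 (by simpa using h.add_edge_mem (h.swap hv))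
  have c₃ := key₂ t₁ 0 0 (by simpa using h.vertex_mem hs₁)
  have c₄ := key₁ 0 t₂ 0 (by simpa using h.vertex_mem hs₂)
  obtain rfl : i₂ = -t₂ := by lia
  obtain rfl : i₁ = -t₁ := by lia
  obtain rfl : t₁ = 1 := by nlinarith
  obtain rfl : t₂ = 1 := by nlinarith
  have c₅ := key₂ (1 + z₁) 0 1 (by
    convert h.add_edge_mem (h.rotate (h.rotate hs₁)) using 1; module)
  have c₆ := key₁ 0 (1 + z₂) 1 (by
    convert h.add_edge_mem (h.rotate (h.rotate hs₂)) using 1; module)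
  obtain rfl : z₁ = z₂ := by lia
  refine ⟨z₁, ?_, ?_⟩
  · convert hs₂ using 1 <;> module
  · convert hs₁ using 1 <;> module

theorem triangle_coord_le (h : IsVertexSystem M o Star) {z a b c : ℤ}
    (hz : Star (v + w₂) (-w₂) (w₁ - w₂) (w₃ + z • w₂))
    (hm : v + a • w₁ + b • w₂ + c • w₃ ∈ M) : a + b ≤ 1 + z * c := by
  have := h.coord_nonneg hz (a := 1 + z * c - a - b) (b := a) (c := c)
    (by convert hm using 1; module)
  lia

/-- Next to a unimodular triangular facet, the lattice points at distance one from it form a full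
triangle of size `1 + z`. -/
theorem triangle_level_one (h : IsVertexSystem M o Star) (hv : Star v w₁ w₂ w₃) {z i j : ℤ}
    (hz₂ : Star (v + w₂) (-w₂) (w₁ - w₂) (w₃ + z • w₂))
    (hz₁ : Star (v + w₁) (-w₁) (w₂ - w₁) (w₃ + z • w₁))
    (hi : 0 ≤ i) (hj : 0 ≤ j) (hij : i + j ≤ 1 + z) : v + i • w₁ + j • w₂ + w₃ ∈ M := by
  have := h.triangle (x := v + w₃) (p := w₁) (q := w₂) (n := 1 + z) (i := i) (j := j)
    (h.add_edge_mem (h.rotate (h.rotate hv)))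
    (by convert h.add_edge_mem (h.rotate (h.rotate hz₁)) using 1; module)
    (by convert h.add_edge_mem (h.rotate (h.rotate hz₂)) using 1; module) hi hj hij
  convert this using 1
  module

/-- The key estimate. `v` need not be a vertex: the hypothesis `hs` only asks for a vertex
`v + t • w₂` on the line through `v` in direction `w₂` whose edge vectors are adapted to the frame
`w₁, w₂, w₃`. If the face through `v + t • w₂` in the directions `w₁, w₂` contains
`v + w₁ + w₂`, and the interior point `o` lies above the latter in direction `w₃`, then there is a
lattice point of `M` of height at most `2` over the next point `v + w₁ + 2 • w₂`. It is found by
means of that face or else of the facet at `v + t • w₂` not containing the direction `w₂`. -/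
theorem exists_low_point (h : IsVertexSystem M o Star) {t s z c₀ : ℤ}
    (hs : Star (v + t • w₂) (-w₂) (w₁ - s • w₂) (w₃ + z • w₂)) (hsq : v + w₁ + w₂ ∈ M)
    (ho : o = v + w₁ + w₂ + c₀ • w₃) (hoM : o ∈ M) (hc₀ : 1 ≤ c₀) :
    ∃ l ≤ (2 : ℤ), v + w₁ + (2 : ℤ) • w₂ + l • w₃ ∈ M := by
  -- The edge from `v + t • w₂` in the direction `w₁ - s • w₂` passes through
  -- `v + w₁ + (t - s) • w₂`, at or beyond `v + w₁ + w₂`.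
  have hts := (h.coord_nonneg hs (a := t - s - 1) (b := 1) (c := 0)
    (by convert hsq using 1; module)).1
  rcases (by lia : 1 ≤ t - s - 1 ∨ t = s + 1) with h2 | rfl
  · refine ⟨0, by norm_num, ?_⟩
    have := h.segment (x := v + w₁ + w₂) (p := w₂) (n := t - s - 1) (i := 1) hsq
      (by convert h.add_edge_mem (h.rotate hs) using 1; module) (by lia) h2
    convert this using 1
    module
  have ho' : o = v + (s + 1) • w₂ + (z * c₀) • (-w₂) + (1 : ℤ) • (w₁ - s • w₂)
      + c₀ • (w₃ + z • w₂) := by rw [ho]; module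
  have hz := h.coord_lt hs (l := -1) (m := 0) (n := 0) (d := 0) ho' (by simp) (by
    intro a b c hm
    have := h.coord_nonneg hs hm
    lia)
  -- The facet `b ≤ t - s a + z c` has `o` strictly on its inner side, which forces `z > 0`.
  have hz1 : 1 ≤ z := by
    by_contra hlt
    nlinarith
  have h111 : v + w₁ + w₂ + w₃ ∈ M := by
    simpa using h.segment (i := 1) hsq (ho ▸ hoM) (by lia) hc₀
  rcases h.square_or_triangle (h.rotate hs) with hm | ⟨k, hk₂, hk₁⟩
  · refine ⟨1, by norm_num, ?_⟩
    have := h.segment (x := v + w₁ + w₂ + w₃) (p := w₂) (n := z) (i := 1) h111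
      (by convert hm using 1; module) (by lia) hz1
    convert this using 1
    module
  · have hkz := h.coord_lt (h.rotate hs) (l := 1) (m := 1) (n := -k) (d := 1)
      (a₀ := 1) (b₀ := c₀) (c₀ := z * c₀) (by rw [ho']; module) (by simp) (by
        intro a b c hm
        have := h.triangle_coord_le hk₂ hm
        lia)
    have hk1 : 1 ≤ k := by
      by_contra hlt
      nlinarith
    rcases (by lia : 2 ≤ z ∨ z = 1) with hz2 | rfl
    · refine ⟨1, by norm_num, ?_⟩
      have h1 := h.triangle_level_one (h.rotate hs) hk₂ hk₁ (i := 1) (j := 1) (by lia) (by lia)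
        (by lia)
      have := h.segment (x := v + w₁ + w₂ + w₃) (p := w₂) (n := z - 1) (i := 1) h111
        (by convert h1 using 1; module) (by lia) (by lia)
      convert this using 1
      module
    · have hk2 : 2 ≤ k := by
        by_contra hlt
        obtain rfl : k = 1 := by lia
        lia
      refine ⟨2, by norm_num, ?_⟩
      convert h.triangle_level_one (h.rotate hs) hk₂ hk₁ (i := 1) (j := 2) (by lia) (by lia)
        (by lia) using 1
      module

/-- If `o` is at height one over a facet with vertex `v`, then near the third edge at `v` there is a
lattice point at height two. -/
theorem exists_level_two_point (h : IsVertexSystem M o Star) (hv : Star v w₁ w₂ w₃) {a₀ b₀ : ℤ}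
    (ho : o = v + a₀ • w₁ + b₀ • w₂ + w₃) (ha₀ : 0 ≤ a₀) (hb₀ : 0 ≤ b₀) :
    ∃ a b : ℤ, 0 ≤ a ∧ 0 ≤ b ∧ a + b ≤ 1 ∧ v + a • w₁ + b • w₂ + (2 : ℤ) • w₃ ∈ M := by
  obtain ⟨t, i, j, ht, hs⟩ := h.move (h.rotate (h.rotate hv))
  rcases (by lia : 2 ≤ t ∨ t = 1) with ht2 | rfl
  · refine ⟨0, 0, le_rfl, le_rfl, by lia, ?_⟩
    convert h.segment (h.vertex_mem hv) (h.vertex_mem hs) (i := 2) (by lia) ht2 using 1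
    module
  have hij := h.coord_lt hs (l := -1) (m := 0) (n := 0) (d := 0) (a₀ := i * a₀ + j * b₀)
    (b₀ := a₀) (c₀ := b₀) (by rw [ho]; module) (by simp) (by
      intro a b c hm
      have := h.coord_nonneg hs hm
      lia)
  have hij' : 1 ≤ i ∨ 1 ≤ j := by
    by_contra! hlt
    nlinarith
  rcases hij' with hi | hj
  · refine ⟨1, 0, by lia, le_rfl, by lia, ?_⟩
    convert h.segment (x := v + w₁) (p := w₃) (n := 1 + i) (i := 2) (h.add_edge_mem hv)
      (by convert h.add_edge_mem (h.rotate hs) using 1; module) (by lia) (by lia) using 1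
    module
  · refine ⟨0, 1, le_rfl, by lia, by lia, ?_⟩
    convert h.segment (x := v + w₂) (p := w₃) (n := 1 + j) (i := 2) (h.add_edge_mem (h.swap hv))
      (by convert h.add_edge_mem (h.rotate (h.rotate hs)) using 1; module) (by lia) (by lia) using 1
    module

/-- Over a triangular facet at distance one from `o`, reflecting the vertex `v` in `o` gives a point
of `M`: it lies in the triangle spanned by three points at height two, one near each of the
three edges leaving the facet. -/
theorem two_two_two_mem (h : IsVertexSystem M o Star) (hv : Star v w₁ w₂ w₃) {z : ℤ}
    (hz₂ : Star (v + w₂) (-w₂) (w₁ - w₂) (w₃ + z • w₂))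
    (hz₁ : Star (v + w₁) (-w₁) (w₂ - w₁) (w₃ + z • w₁)) (hz : 2 ≤ z)
    (ho : o = v + w₁ + w₂ + w₃) : v + (2 : ℤ) • w₁ + (2 : ℤ) • w₂ + (2 : ℤ) • w₃ ∈ M := by
  obtain ⟨a₁, a₂, ha₁, ha₂, ha, hA⟩ := h.exists_level_two_point hv (a₀ := 1) (b₀ := 1)
    (by rw [ho]; module) (by lia) (by lia)
  obtain ⟨b₀, b₂, hb₀, hb₂, hb, hB⟩ := h.exists_level_two_point hz₁ (a₀ := z - 1) (b₀ := 1)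
    (by rw [ho]; module) (by lia) (by lia)
  obtain ⟨c₀, c₁, hc₀, hc₁, hc, hC⟩ := h.exists_level_two_point hz₂ (a₀ := z - 1) (b₀ := 1)
    (by rw [ho]; module) (by lia) (by lia)
  obtain ⟨e, rfl⟩ : ∃ e, z = 2 + e := ⟨z - 2, by ring⟩
  -- Barycentric coordinates of the target in the triangle of the three points `hA`, `hB`, `hC`.
  have p₁ : 0 ≤ (2 * (2 + e) - 1 - b₀ - b₂) * (2 * (2 + e) - 1 - c₀ - c₁)
      - (2 - b₂) * (2 - c₁) := by
    nlinarith
  have p₂ : 0 ≤ (2 - a₁) * (2 * (2 + e) - 1 - c₀ - c₁) + (2 - a₂) * (2 - c₁) := by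
    nlinarith
  have p₃ : 0 ≤ (2 - a₂) * (2 * (2 + e) - 1 - b₀ - b₂) + (2 - a₁) * (2 - b₂) := by
    nlinarith
  have p₄ : 0 < (2 - a₁) * (2 * (2 + e) - 1 - c₀ - c₁) + (2 - a₂) * (2 - c₁) := by
    nlinarith
  refine h.convex hA hB hC p₁ p₂ p₃ (by lia) ?_
  module

/-- Integer combinations of a lattice basis with coefficient matrix of determinant one form a
lattice basis. -/
theorem exists_basis_of_det (h : IsVertexSystem M o Star) (hv : Star v w₁ w₂ w₃)
    (A : Matrix (Fin 3) (Fin 3) ℤ) (hA : A.det = 1) :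
    ∃ C : Module.Basis (Fin 3) ℤ (Fin 3 → ℤ),
      ∀ i, C i = A i 0 • w₁ + A i 1 • w₂ + A i 2 • w₃ := by
  obtain ⟨B, rfl, rfl, rfl⟩ := h.basis hv
  let d : Fin 3 → Fin 3 → ℤ := fun i => A i 0 • B 0 + A i 1 • B 1 + A i 2 • B 2
  have hd : B.toMatrix d = A.transpose := by
    ext j i
    fin_cases j <;>
      simp only [d, Module.Basis.toMatrix_apply, map_add, map_smul, Module.Basis.repr_self,
        Finsupp.coe_add, Finsupp.coe_smul, Pi.add_apply, Pi.smul_apply, Finsupp.single_apply] <;>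
      simp
  have hu : IsUnit (B.det d) := by
    rw [Module.Basis.det_apply, hd, Matrix.det_transpose, hA]
    exact isUnit_one
  obtain ⟨hli, hsp⟩ := (Module.Basis.is_basis_iff_det B).mpr hu
  exact ⟨Module.Basis.mk hli hsp.ge, fun i => by rw [Module.Basis.mk_apply]⟩

theorem low_point_of_square (h : IsVertexSystem M o Star) (hv : Star v w₁ w₂ w₃) {c₀ : ℤ}
    (hsq : v + w₁ + w₂ ∈ M) (ho : o = v + w₁ + w₂ + c₀ • w₃) (hoM : o ∈ M) (hc₀ : 1 ≤ c₀) :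
    ∃ l ≤ 2 * c₀, v + w₁ + (2 : ℤ) • w₂ + l • w₃ ∈ M := by
  obtain ⟨t, i, z, ht, hs⟩ := h.move (h.swap hv)
  obtain ⟨l, hl, hm⟩ := h.exists_low_point (t := t) (s := -i) (z := z)
    (by convert hs using 1; module) hsq ho hoM hc₀
  exact ⟨l, by lia, hm⟩

theorem low_point_of_triangle (h : IsVertexSystem M o Star) (hv : Star v w₁ w₂ w₃) {c₀ z : ℤ}
    (hz₂ : Star (v + w₂) (-w₂) (w₁ - w₂) (w₃ + z • w₂))
    (hz₁ : Star (v + w₁) (-w₁) (w₂ - w₁) (w₃ + z • w₁)) (hz : 1 ≤ z)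
    (ho : o = v + w₁ + w₂ + c₀ • w₃) (hoM : o ∈ M) (hc₀ : 2 ≤ c₀) :
    ∃ l ≤ 2 * c₀, v + w₁ + (2 : ℤ) • w₂ + l • w₃ ∈ M := by
  rcases (by lia : 2 ≤ z ∨ z = 1) with hz' | rfl
  · refine ⟨1, by lia, ?_⟩
    convert h.triangle_level_one hv hz₂ hz₁ (i := 1) (j := 2) (by lia) (by lia) (by lia) using 1
    module
  -- For `z = 1`, lowering the triangular facet by one step shrinks it to the point `v - w₃`, with
  -- edge vectors `w₁ + w₃`, `w₂ + w₃`, `w₃`: a virtual vertex to which the key estimate applies.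
  · obtain ⟨t, i, j, ht, hs⟩ := h.move (h.rotate (h.rotate hz₂))
    obtain ⟨l, hl, hm⟩ := h.exists_low_point (v := v - w₃) (w₁ := w₁ + w₃) (w₂ := w₂ + w₃)
      (w₃ := w₃) (t := t + 1) (s := 1 - j) (z := i - 1) (c₀ := c₀ - 1)
      (by convert h.rotate (h.rotate (h.swap (h.rotate hs))) using 1 <;> module)
      (by
        convert h.triangle_level_one hv hz₂ hz₁ (i := 1) (j := 1) (by lia) (by lia) (by lia) using 1
        module)
      (by rw [ho]; module) hoM (by lia)
    refine ⟨l + 2, by lia, ?_⟩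
    convert hm using 1
    module

/-- If `o` has distance one from the two facets through the edge of direction `w₃` at `v`, then
either `M` contains a lattice basis, based at `o`, together with its reflection in `o`, or `M`
contains `o - w₃` and, in both directions across the edge, a point low enough for its reflection in
`o` to have nonnegative height. The first case arises from a triangular facet at distance one. -/
theorem basis_or_low_points (h : IsVertexSystem M o Star) (hv : Star v w₁ w₂ w₃) {c₀ : ℤ}
    (ho : o = v + w₁ + w₂ + c₀ • w₃) (hoM : o ∈ M) :
    (∃ B : Module.Basis (Fin 3) ℤ (Fin 3 → ℤ), ∀ i, o + B i ∈ M ∧ o - B i ∈ M) ∨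
      (o - w₃ ∈ M ∧ (∃ l ≤ 2 * c₀, v + w₁ + (2 : ℤ) • w₂ + l • w₃ ∈ M) ∧
        ∃ l ≤ 2 * c₀, v + (2 : ℤ) • w₁ + w₂ + l • w₃ ∈ M) := by
  have ho' : o = v + w₂ + w₁ + c₀ • w₃ := by rw [ho]; module
  have hc₀ := h.coord_lt hv (l := 0) (m := 0) (n := -1) (d := 0) (a₀ := 1) (b₀ := 1) (c₀ := c₀)
    (by rw [ho]; module) (by simp) (by
      intro a b c hm
      have := h.coord_nonneg hv hm
      lia)
  rcases h.square_or_triangle hv with hsq | ⟨z, hz₂, hz₁⟩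
  · right
    obtain ⟨l, hl, hm⟩ := h.low_point_of_square hv hsq ho hoM (by lia)
    obtain ⟨l', hl', hm'⟩ := h.low_point_of_square (h.swap hv)
      (by convert hsq using 1; module) ho' hoM (by lia)
    refine ⟨?_, ⟨l, hl, hm⟩, l', hl', by convert hm' using 1; module⟩
    convert h.segment (x := v + w₁ + w₂) (p := w₃) (n := c₀) (i := c₀ - 1) hsq (ho ▸ hoM)
      (by lia) (by lia) using 1
    rw [ho]
    module
  have hzc := h.coord_lt hv (l := 1) (m := 1) (n := -z) (d := 1) (a₀ := 1) (b₀ := 1) (c₀ := c₀)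
    (by rw [ho]; module) (by simp) (by
      intro a b c hm
      have := h.triangle_coord_le hz₂ hm
      lia)
  have level := fun (i j : ℤ) => h.triangle_level_one hv hz₂ hz₁ (i := i) (j := j)
  rcases (by lia : 2 ≤ c₀ ∨ c₀ = 1) with hc | rfl
  · right
    have hz : 1 ≤ z := by
      by_contra hlt
      nlinarith
    obtain ⟨l, hl, hm⟩ := h.low_point_of_triangle hv hz₂ hz₁ hz ho hoM hc
    obtain ⟨l', hl', hm'⟩ := h.low_point_of_triangle (h.swap hv) hz₁ hz₂ hz ho' hoM hc
    refine ⟨?_, ⟨l, hl, hm⟩, l', hl', by convert hm' using 1; module⟩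
    convert h.segment (x := v + w₁ + w₂ + w₃) (p := w₃) (n := c₀ - 1) (i := c₀ - 2)
      (by convert level 1 1 (by lia) (by lia) (by lia) using 1; module)
      (by convert hoM using 1; rw [ho]; module) (by lia) (by lia) using 1
    rw [ho]
    module
  · left
    obtain ⟨C, hC⟩ := h.exists_basis_of_det hv !![1, 0, 0; 0, 1, 0; 1, 1, 1]
      (by simp [Matrix.det_fin_three])
    have h222 := h.two_two_two_mem hv hz₂ hz₁ (by lia) (by rw [ho]; module)
    have e₀ : C 0 = w₁ := by rw [hC]; simp
    have e₁ : C 1 = w₂ := by rw [hC]; simp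
    have e₂ : C 2 = w₁ + w₂ + w₃ := by rw [hC]; simp
    refine ⟨C, fun i => ?_⟩
    fin_cases i
    · change o + C 0 ∈ M ∧ o - C 0 ∈ M
      rw [e₀, ho]
      constructor
      · convert level 2 1 (by lia) (by lia) (by lia) using 1
        module
      · convert level 0 1 (by lia) (by lia) (by lia) using 1
        module
    · change o + C 1 ∈ M ∧ o - C 1 ∈ M
      rw [e₁, ho]
      constructor
      · convert level 1 2 (by lia) (by lia) (by lia) using 1
        module
      · convert level 1 0 (by lia) (by lia) (by lia) using 1
        module
    · change o + C 2 ∈ M ∧ o - C 2 ∈ M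
      rw [e₂, ho]
      constructor
      · convert h222 using 1
        module
      · convert h.vertex_mem hv using 1
        module

theorem exists_point_between (h : IsVertexSystem M o Star) {x p : Fin 3 → ℤ} {l u a b : ℤ}
    (hl : x + l • p ∈ M) (hu : x + u • p ∈ M) (hlb : l ≤ b) (hau : a ≤ u) (hab : a ≤ b) :
    ∃ r, a ≤ r ∧ r ≤ b ∧ x + r • p ∈ M := by
  by_cases h1 : u ≤ b
  · exact ⟨u, hau, h1, hu⟩
  by_cases h2 : a ≤ l
  · exact ⟨l, h2, hlb, hl⟩
  refine ⟨b, hab, le_rfl, ?_⟩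
  convert h.segment (x := x + l • p) (p := p) (n := u - l) (i := b - l) hl
    (by convert hu using 1; module) (by lia) (by lia) using 1
  module

/-- If the interior lattice point `o` is at distance one from both facets through an edge, then `M`
contains some lattice basis, based at `o`, together with its reflection in `o`. -/
theorem exists_basis (h : IsVertexSystem M o Star) (hv : Star v w₁ w₂ w₃) {c₀ : ℤ}
    (ho : o = v + w₁ + w₂ + c₀ • w₃) (hoM : o ∈ M) :
    ∃ B : Module.Basis (Fin 3) ℤ (Fin 3 → ℤ), ∀ i, o + B i ∈ M ∧ o - B i ∈ M := by
  obtain ⟨t, i, j, ht, hs⟩ := h.move (h.rotate (h.rotate hv))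
  rcases h.basis_or_low_points hv ho hoM with hB | ⟨hw, ⟨l₁, hl₁, hm₁⟩, l₂, hl₂, hm₂⟩
  · exact hB
  rcases h.basis_or_low_points (h.rotate hs) (c₀ := t + i + j - c₀) (by rw [ho]; module) hoM with
    hB | ⟨hw', ⟨u₁, hu₁, hn₁⟩, u₂, hu₂, hn₂⟩
  · exact hB
  have hp := h.add_edge_mem (h.rotate hs)
  have hq := h.add_edge_mem (h.rotate (h.rotate hs))
  have hi := (h.coord_nonneg hv (a := 1) (b := 0) (c := t + i)
    (by convert hp using 1; module)).2.2
  have hj := (h.coord_nonneg hv (a := 0) (b := 1) (c := t + j)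
    (by convert hq using 1; module)).2.2
  -- `v + w₁ + 2 • w₂ + r₁ • w₃` has to be the reflection in `o` of a point of the
  -- segment of the points `v + w₁ + c • w₃`, `0 ≤ c ≤ t + i`.
  obtain ⟨r₁, hr₁, hr₁', hR₁⟩ := h.exists_point_between (x := v + w₁ + (2 : ℤ) • w₂) (p := w₃)
    (l := l₁) (u := t + i + 2 * j - u₁) (a := 2 * c₀ - (t + i)) (b := 2 * c₀) hm₁
    (by convert hn₁ using 1; module) hl₁ (by lia) (by lia)
  obtain ⟨r₂, hr₂, hr₂', hR₂⟩ := h.exists_point_between (x := v + (2 : ℤ) • w₁ + w₂) (p := w₃)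
    (l := l₂) (u := t + 2 * i + j - u₂) (a := 2 * c₀ - (t + j)) (b := 2 * c₀) hm₂
    (by convert hn₂ using 1; module) hl₂ (by lia) (by lia)
  have hS₁ := h.segment (x := v + w₁) (p := w₃) (n := t + i) (i := 2 * c₀ - r₁)
    (h.add_edge_mem hv) (by convert hp using 1; module) (by lia) (by lia)
  have hS₂ := h.segment (x := v + w₂) (p := w₃) (n := t + j) (i := 2 * c₀ - r₂)
    (h.add_edge_mem (h.swap hv)) (by convert hq using 1; module) (by lia) (by lia)
  obtain ⟨C, hC⟩ := h.exists_basis_of_det hv !![1, 0, r₂ - c₀; 0, 1, r₁ - c₀; 0, 0, 1]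
    (by simp [Matrix.det_fin_three])
  have e₀ : C 0 = w₁ + (r₂ - c₀) • w₃ := by rw [hC]; simp
  have e₁ : C 1 = w₂ + (r₁ - c₀) • w₃ := by rw [hC]; simp
  have e₂ : C 2 = w₃ := by rw [hC]; simp
  refine ⟨C, fun i => ?_⟩
  fin_cases i
  · change o + C 0 ∈ M ∧ o - C 0 ∈ M
    rw [e₀, ho]
    constructor
    · convert hR₂ using 1
      module
    · convert hS₂ using 1
      module
  · change o + C 1 ∈ M ∧ o - C 1 ∈ M
    rw [e₁, ho]
    constructor
    · convert hR₁ using 1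
      module
    · convert hS₁ using 1
      module
  · change o + C 2 ∈ M ∧ o - C 2 ∈ M
    rw [e₂]
    exact ⟨by simpa using hw', hw⟩

end IsVertexSystem

/-! ### Lattice vectors and integral functionals -/

section LatticeVectors

variable {n : ℕ}

theorem toReal_add (x y : Fin n → ℤ) : toReal (x + y) = toReal x + toReal y := by
  ext i; simp [toReal]

theorem toReal_sub (x y : Fin n → ℤ) : toReal (x - y) = toReal x - toReal y := by
  ext i; simp [toReal]

theorem toReal_neg (x : Fin n → ℤ) : toReal (-x) = -toReal x := by
  ext i; simp [toReal]

theorem toReal_zero : toReal (0 : Fin n → ℤ) = 0 := by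
  ext i; simp [toReal]

theorem toReal_smul (a : ℤ) (x : Fin n → ℤ) : toReal (a • x) = (a : ℝ) • toReal x := by
  ext i; simp [toReal]

theorem toReal_injective : Function.Injective (toReal : (Fin n → ℤ) → Fin n → ℝ) := by
  intro x y h
  ext i
  simpa [toReal] using congrFun h i

theorem toReal_dotProduct (u z : Fin n → ℤ) : toReal u ⬝ᵥ toReal z = ((u ⬝ᵥ z : ℤ) : ℝ) := by
  simp [toReal, dotProduct]

theorem isPrimitiveVector_of_dotProduct_eq_one {u w : Fin n → ℤ} (h : u ⬝ᵥ w = 1) :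
    IsPrimitiveVector u := by
  have hd : Finset.univ.gcd u ∣ 1 := by
    rw [← h]
    exact Finset.dvd_sum fun i _ => (Finset.gcd_dvd (Finset.mem_univ i)).mul_right _
  rw [IsPrimitiveVector, ← Finset.normalize_gcd]
  exact normalize_eq_one.mpr (isUnit_of_dvd_one hd)

theorem IsPrimitiveVector.exists_dotProduct_eq_one {w : Fin n → ℤ} (hw : IsPrimitiveVector w) :
    ∃ u : Fin n → ℤ, u ⬝ᵥ w = 1 := by
  obtain ⟨u, hu⟩ := Finset.gcd_eq_sum_mul Finset.univ w
  refine ⟨u, ?_⟩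
  rw [← hw, hu]
  simp [dotProduct, mul_comm]

theorem IsPrimitiveVector.neg {w : Fin n → ℤ} (hw : IsPrimitiveVector w) :
    IsPrimitiveVector (-w) := by
  obtain ⟨u, hu⟩ := hw.exists_dotProduct_eq_one
  exact isPrimitiveVector_of_dotProduct_eq_one (w := -u)
    (by rw [neg_dotProduct_neg, dotProduct_comm, hu])

theorem IsPrimitiveVector.ne_zero {w : Fin n → ℤ} (hw : IsPrimitiveVector w) : w ≠ 0 := by
  rintro rfl
  obtain ⟨u, hu⟩ := hw.exists_dotProduct_eq_one
  simp at hu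

theorem exists_primitive {d : Fin n → ℤ} (hd : d ≠ 0) :
    ∃ (w : Fin n → ℤ) (g : ℤ), IsPrimitiveVector w ∧ 0 < g ∧ d = g • w := by
  obtain ⟨i, hi⟩ := Function.ne_iff.mp hd
  obtain ⟨w, hw, hw1⟩ := Finset.extract_gcd d (s := Finset.univ) ⟨i, Finset.mem_univ i⟩
  refine ⟨w, Finset.univ.gcd d, hw1, ?_, ?_⟩
  · refine lt_of_le_of_ne (Int.nonneg_of_normalize_eq_self Finset.normalize_gcd) fun h0 => hi ?_
    rw [hw i (Finset.mem_univ i), ← h0, zero_mul]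
    rfl
  · ext j
    simpa using hw j (Finset.mem_univ j)

/-- The scalar product with `u`, as a continuous linear functional. -/
noncomputable def dotFunctional (u : Fin n → ℝ) : StrongDual ℝ (Fin n → ℝ) :=
  LinearMap.toContinuousLinearMap
    { toFun := fun x => u ⬝ᵥ x
      map_add' := dotProduct_add u
      map_smul' := fun c x => dotProduct_smul c u x }

@[simp]
theorem dotFunctional_apply (u x : Fin n → ℝ) : dotFunctional u x = u ⬝ᵥ x := rfl

/-- The vector of coefficients of an integral linear functional in the standard basis, so that the
functional is the scalar product with this vector. -/
def coordVector (f : (Fin n → ℤ) →ₗ[ℤ] ℤ) : Fin n → ℤ := fun j => f (Pi.single j 1)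

theorem coordVector_dotProduct (f : (Fin n → ℤ) →ₗ[ℤ] ℤ) (z : Fin n → ℤ) :
    coordVector f ⬝ᵥ z = f z := by
  conv_rhs => rw [LinearMap.pi_apply_eq_sum_univ f z]
  simp only [dotProduct, coordVector, smul_eq_mul]
  refine Finset.sum_congr rfl fun i _ => ?_
  rw [mul_comm]
  congr 2
  ext j
  simp [Pi.single_apply, eq_comm]

end LatticeVectors

/-! ### Vertices and edges of polytopes -/

section Polytopes

variable {n : ℕ} {P : Set (Fin n → ℝ)}

/-- A vertex of a polytope is exposed: it is strictly separated from the other vertices. -/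
theorem exists_forall_lt_of_extreme {S : Set (Fin n → ℝ)} (hS : S.Finite) {v : Fin n → ℝ}
    (hv : v ∈ (convexHull ℝ S).extremePoints ℝ) :
    ∃ l : StrongDual ℝ (Fin n → ℝ), ∀ s ∈ S, s ≠ v → l v < l s := by
  have hnot : v ∉ convexHull ℝ (S \ {v}) := by
    intro hmem
    have := inter_extremePoints_subset_extremePoints_of_subset (𝕜 := ℝ)
      (convexHull_mono (𝕜 := ℝ) (Set.sdiff_subset (s := S) (t := {v}))) ⟨hmem, hv⟩
    exact (extremePoints_convexHull_subset this).2 rfl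
  obtain ⟨l, u, h1, h2⟩ := geometric_hahn_banach_point_closed (convex_convexHull ℝ _)
    ((hS.subset Set.sdiff_subset).isClosed_convexHull ℝ) hnot
  exact ⟨l, fun s hs hne => h1.trans (h2 s (subset_convexHull ℝ _ ⟨hs, hne⟩))⟩

theorem IsPolytope.isCompact (hP : IsPolytope P) : IsCompact P := by
  obtain ⟨S, hS, rfl⟩ := hP
  exact hS.isCompact_convexHull ℝ

theorem IsPolytope.convex (hP : IsPolytope P) : Convex ℝ P := by
  obtain ⟨S, hS, rfl⟩ := hP
  exact convex_convexHull ℝ S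

theorem IsPolytope.finite_extremePoints (hP : IsPolytope P) : (P.extremePoints ℝ).Finite := by
  obtain ⟨S, hS, rfl⟩ := hP
  exact hS.subset extremePoints_convexHull_subset

theorem IsPolytope.eq_convexHull_extremePoints (hP : IsPolytope P) :
    P = convexHull ℝ (P.extremePoints ℝ) := by
  conv_lhs => rw [← closure_convexHull_extremePoints hP.isCompact hP.convex]
  exact (hP.finite_extremePoints.isClosed_convexHull ℝ).closure_eq

theorem IsPolytope.le_of_extremePoints (hP : IsPolytope P) {f : StrongDual ℝ (Fin n → ℝ)} {c : ℝ}
    (hf : ∀ s ∈ P.extremePoints ℝ, c ≤ f s) {x : Fin n → ℝ} (hx : x ∈ P) : c ≤ f x := by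
  rw [hP.eq_convexHull_extremePoints] at hx
  exact convexHull_min (t := {y | c ≤ f y}) hf
    (convex_halfSpace_ge f.toLinearMap.isLinear c) hx

/-- The step of the simplex method: a linear functional which is not minimal on `P` at the vertex
`v` decreases along some edge at `v`. The edge comes from a vertex of the vertex figure of `P`
at `v`. -/
theorem IsPolytope.exists_edge_of_lt (hP : IsPolytope P) {v x : Fin n → ℝ}
    (hv : v ∈ P.extremePoints ℝ) {f : StrongDual ℝ (Fin n → ℝ)} (hx : x ∈ P) (hfx : f x < f v) :
    ∃ F, IsEdge P F ∧ v ∈ F ∧ ∃ s ∈ P.extremePoints ℝ, s ∈ F ∧ f s < f v := by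
  set T := P.extremePoints ℝ \ {v}
  have hTfin : T.Finite := hP.finite_extremePoints.subset Set.sdiff_subset
  obtain ⟨g, hg⟩ : ∃ g : StrongDual ℝ (Fin n → ℝ), ∀ s ∈ T, g v < g s := by
    obtain ⟨g, hg⟩ := exists_forall_lt_of_extreme hP.finite_extremePoints
      (v := v) (by rwa [← hP.eq_convexHull_extremePoints])
    exact ⟨g, fun s hs => hg s hs.1 hs.2⟩
  obtain ⟨s₁, hs₁, hfs₁⟩ : ∃ s ∈ T, f s < f v := by
    by_contra! hcon
    refine absurd (hP.le_of_extremePoints (f := f) (c := f v) (fun s hs => ?_) hx) (not_le.mpr hfx)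
    rcases eq_or_ne s v with rfl | hne
    · exact le_rfl
    · exact hcon s ⟨hs, hne⟩
  -- The vertex figure: the directions from `v` to the other vertices, normalised by `g`.
  let κ : (Fin n → ℝ) → (Fin n → ℝ) := fun s => (g s - g v)⁻¹ • (s - v)
  have hκ : ∀ s ∈ T, s - v = (g s - g v) • κ s := by
    intro s hs
    rw [smul_inv_smul₀ (sub_pos.mpr (hg s hs)).ne']
  have hgκ : ∀ s ∈ T, g (κ s) = 1 := by
    intro s hs
    simp only [κ, map_smul, map_sub, smul_eq_mul]
    exact inv_mul_cancel₀ (sub_pos.mpr (hg s hs)).ne'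
  have hKfin : (κ '' T).Finite := hTfin.image κ
  set K := convexHull ℝ (κ '' T)
  have hKc : IsCompact K := hKfin.isCompact_convexHull ℝ
  have hs₁K : κ s₁ ∈ K := subset_convexHull ℝ _ ⟨s₁, hs₁, rfl⟩
  obtain ⟨k₀, hk₀, hmin⟩ := hKc.exists_isMinOn ⟨_, hs₁K⟩ f.continuous.continuousOn
  have hexp : IsExposed ℝ K ((-f).toExposed K) := ContinuousLinearMap.toExposed.isExposed
  obtain ⟨k, hk⟩ := (hexp.isCompact hKc).extremePoints_nonempty
    ⟨k₀, hk₀, fun y hy => by simpa using hmin hy⟩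
  have hkK : k ∈ K.extremePoints ℝ := hexp.isExtreme.extremePoints_subset_extremePoints hk
  have hfk : f k < 0 := by
    have h1 : f k ≤ f (κ s₁) := by simpa using (extremePoints_subset hk).2 _ hs₁K
    refine h1.trans_lt ?_
    simp only [κ, map_smul, map_sub, smul_eq_mul]
    exact mul_neg_of_pos_of_neg (inv_pos.mpr (sub_pos.mpr (hg s₁ hs₁))) (sub_neg.mpr hfs₁)
  obtain ⟨s₀, hs₀, rfl⟩ := extremePoints_convexHull_subset hkK
  obtain ⟨l, hl⟩ := exists_forall_lt_of_extreme hKfin hkK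
  have hl' : ∀ s ∈ T, κ s ≠ κ s₀ → l (κ s₀) < l (κ s) := fun s hs hne => hl _ ⟨s, hs, rfl⟩ hne
  -- The functional `H` is minimal on the ray from `v` in the direction `κ s₀` only.
  let H : StrongDual ℝ (Fin n → ℝ) := l - l (κ s₀) • g
  have hH : ∀ s ∈ T, H s - H v = (g s - g v) * (l (κ s) - l (κ s₀)) := by
    intro s hs
    rw [← map_sub, hκ s hs, map_smul, smul_eq_mul]
    simp [H, hgκ s hs]
  have hHv : ∀ y ∈ P, H v ≤ H y := by
    intro y hy
    refine hP.le_of_extremePoints (fun s hs => ?_) hy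
    rcases eq_or_ne s v with rfl | hne
    · exact le_rfl
    have hsT : s ∈ T := ⟨hs, hne⟩
    have := hH s hsT
    have h2 : 0 ≤ l (κ s) - l (κ s₀) := by
      rcases eq_or_ne (κ s) (κ s₀) with he | he
      · simp [he]
      · exact (sub_pos.mpr (hl' s hsT he)).le
    have := mul_nonneg (sub_pos.mpr (hg s hsT)).le h2
    linarith
  have hF : IsExposed ℝ P ((-H).toExposed P) := ContinuousLinearMap.toExposed.isExposed
  set F := (-H).toExposed P
  have hvF : v ∈ F := ⟨extremePoints_subset hv, fun y hy => by simpa using hHv y hy⟩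
  have hs₀F : s₀ ∈ F := by
    refine ⟨extremePoints_subset hs₀.1, fun y hy => ?_⟩
    have h1 := hH s₀ hs₀
    have h2 := hHv y hy
    simp only [sub_self, mul_zero] at h1
    simp only [neg_apply, neg_le_neg_iff]
    linarith
  have hk0 : κ s₀ ≠ 0 := by
    intro h0
    simp [h0] at hfk
  have hsub : F ⊆ {y | y - v ∈ Submodule.span ℝ {κ s₀}} := by
    rw [← closure_convexHull_extremePoints (hF.isCompact hP.isCompact) (hF.convex hP.convex)]
    have hclosed : IsClosed {y | y - v ∈ Submodule.span ℝ {κ s₀}} :=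
      (Submodule.closed_of_finiteDimensional (Submodule.span ℝ {κ s₀})).preimage
        (continuous_id.sub continuous_const)
    refine closure_minimal (convexHull_min ?_ ?_) hclosed
    · intro t ht
      have htP := hF.isExtreme.extremePoints_subset_extremePoints ht
      rcases eq_or_ne t v with rfl | hne
      · simp
      have htT : t ∈ T := ⟨htP, hne⟩
      have h1 : H t ≤ H v := by
        simpa using (extremePoints_subset ht).2 v (extremePoints_subset hv)
      have h2 := hH t htT
      have h3 : κ t = κ s₀ := by
        by_contra hne'
        have := mul_pos (sub_pos.mpr (hg t htT)) (sub_pos.mpr (hl' t htT hne'))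
        linarith
      rw [Set.mem_ofPred_eq, hκ t htT, h3]
      exact Submodule.smul_mem _ _ (Submodule.mem_span_singleton_self _)
    · intro y hy z hz a b ha hb hab
      have : a • y + b • z - v = a • (y - v) + b • (z - v) := by
        rw [← eq_sub_iff_add_eq] at hab
        subst hab
        module
      rw [Set.mem_ofPred_eq, this]
      exact Submodule.add_mem _ (Submodule.smul_mem _ _ hy) (Submodule.smul_mem _ _ hz)
  refine ⟨F, ⟨⟨v, hvF⟩, hF, ?_⟩, hvF, s₀, hs₀.1, hs₀F, ?_⟩
  · have hspan : vectorSpan ℝ F = Submodule.span ℝ {κ s₀} := by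
      refine le_antisymm ?_ ?_
      · rw [vectorSpan_def, Submodule.span_le]
        rintro _ ⟨y, hy, z, hz, rfl⟩
        have hyk : y - v ∈ Submodule.span ℝ {κ s₀} := hsub hy
        have hzk : z - v ∈ Submodule.span ℝ {κ s₀} := hsub hz
        simpa using Submodule.sub_mem _ hyk hzk
      · rw [Submodule.span_singleton_le_iff_mem]
        have h1 : s₀ - v ∈ vectorSpan ℝ F := vsub_mem_vectorSpan ℝ hs₀F hvF
        exact Submodule.smul_mem _ _ h1
    rw [polyDim, hspan, finrank_span_singleton hk0]
  · have h1 := congrArg f (hκ s₀ hs₀)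
    rw [map_sub, map_smul, smul_eq_mul] at h1
    have := mul_neg_of_pos_of_neg (sub_pos.mpr (hg s₀ hs₀)) hfk
    linarith

/-- A lattice polytope lies in the cone spanned at a vertex by its primitive edge vectors, in dual
form. -/
theorem IsLatticePolytope.le_of_edgeVectors (hP : IsLatticePolytope P) {v x : Fin n → ℝ}
    (hv : v ∈ P.extremePoints ℝ) {f : StrongDual ℝ (Fin n → ℝ)}
    (hf : ∀ w ∈ primitiveEdgeVectors P v, 0 ≤ f (toReal w)) (hx : x ∈ P) : f v ≤ f x := by
  by_contra! hlt
  obtain ⟨F, hF, hvF, s, hs, hsF, hfs⟩ := hP.1.exists_edge_of_lt hv hx hlt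
  obtain ⟨a, rfl⟩ := hP.2 v hv
  obtain ⟨b, rfl⟩ := hP.2 s hs
  have hne : b - a ≠ 0 := by
    intro h0
    rw [sub_eq_zero.mp h0] at hfs
    exact lt_irrefl _ hfs
  obtain ⟨w, g, hw, hg, hd⟩ := exists_primitive hne
  have hb : toReal b = toReal a + (g : ℝ) • toReal w := by
    rw [← toReal_smul, ← toReal_add, ← hd, add_sub_cancel]
  have hg' : (0 : ℝ) < g := by exact_mod_cast hg
  have h0 := hf w ⟨hw, F, hF, hvF, g, hg', hb ▸ hsF⟩
  rw [hb, map_add, map_smul, smul_eq_mul] at hfs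
  have := mul_nonneg hg'.le h0
  linarith

theorem IsEdge.mem_span_of_mem {e : Set (Fin n → ℝ)} (he : IsEdge P e) {d : Fin n → ℝ}
    (hd : d ∈ vectorSpan ℝ e) (hd0 : d ≠ 0) {x y : Fin n → ℝ} (hx : x ∈ e) (hy : y ∈ e) :
    ∃ r : ℝ, y - x = r • d := by
  have h1 : Module.finrank ℝ (vectorSpan ℝ e) = 1 := he.2.2
  obtain ⟨r, hr⟩ := (finrank_eq_one_iff_of_nonzero' (⟨d, hd⟩ : vectorSpan ℝ e)
    (by simpa using hd0)).mp h1 ⟨y - x, vsub_mem_vectorSpan ℝ hy hx⟩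
  exact ⟨r, by simpa using (congrArg Subtype.val hr).symm⟩

/-- An edge of a lattice polytope ends in a second vertex, and from there its primitive vector is
the opposite one. -/
theorem IsLatticePolytope.exists_opposite_vertex (hP : IsLatticePolytope P) {v w : Fin n → ℤ}
    (hw : w ∈ primitiveEdgeVectors P (toReal v)) :
    ∃ t : ℤ, 1 ≤ t ∧ toReal (v + t • w) ∈ P.extremePoints ℝ ∧
      -w ∈ primitiveEdgeVectors P (toReal (v + t • w)) := by
  obtain ⟨hwp, e, he, hve, t, ht, hte⟩ := hw
  have hec : IsCompact e := he.2.1.isCompact hP.1.isCompact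
  have hw0 : toReal w ≠ 0 := by
    rw [← toReal_zero]
    exact fun h0 => hwp.ne_zero (toReal_injective h0)
  have hwe : toReal w ∈ vectorSpan ℝ e := by
    have h1 := vsub_mem_vectorSpan ℝ hte hve
    rw [vsub_eq_sub, add_sub_cancel_left] at h1
    simpa [smul_smul, ht.ne'] using Submodule.smul_mem _ t⁻¹ h1
  -- The other end is a vertex of the face of `e` on which the product with `w` is maximal.
  set f := dotFunctional (toReal w) with hf
  obtain ⟨m, hm, hmax⟩ := hec.exists_isMaxOn ⟨_, hve⟩ f.continuous.continuousOn
  have hexp : IsExposed ℝ e (f.toExposed e) := ContinuousLinearMap.toExposed.isExposed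
  obtain ⟨y, hy⟩ := (hexp.isCompact hec).extremePoints_nonempty ⟨m, hm, fun z hz => hmax hz⟩
  have hye : y ∈ e := (extremePoints_subset hy).1
  have hyP : y ∈ P.extremePoints ℝ := he.2.1.isExtreme.extremePoints_subset_extremePoints
    (hexp.isExtreme.extremePoints_subset_extremePoints hy)
  obtain ⟨z, rfl⟩ := hP.2 y hyP
  obtain ⟨r, hr⟩ := he.mem_span_of_mem hwe hw0 hve hye
  obtain ⟨u, hu⟩ := hwp.exists_dotProduct_eq_one
  have hr' : r = ((u ⬝ᵥ (z - v) : ℤ) : ℝ) := by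
    rw [← toReal_dotProduct, toReal_sub, hr, dotProduct_smul, toReal_dotProduct, hu]
    simp
  have hrpos : 0 < r := by
    have h1 : f (toReal v + t • toReal w) ≤ f (toReal z) := (extremePoints_subset hy).2 _ hte
    rw [eq_add_of_sub_eq' hr, map_add, map_add, map_smul, map_smul, smul_eq_mul, smul_eq_mul] at h1
    have hpos : 0 < toReal w ⬝ᵥ toReal w :=
      lt_of_le_of_ne (Finset.sum_nonneg fun i _ => mul_self_nonneg _)
        (Ne.symm (mt dotProduct_self_eq_zero.mp hw0))
    have : t * (toReal w ⬝ᵥ toReal w) ≤ r * (toReal w ⬝ᵥ toReal w) := by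
      simp only [hf, dotFunctional_apply] at h1
      linarith
    exact ht.trans_le (le_of_mul_le_mul_right this hpos)
  set k := u ⬝ᵥ (z - v) with hk
  have hz : z = v + k • w := by
    apply toReal_injective
    rw [toReal_add, toReal_smul, ← hr', ← hr, add_sub_cancel]
  have hk1 : 0 < k := by
    rw [hr'] at hrpos
    exact_mod_cast hrpos
  refine ⟨k, hk1, hz ▸ hyP, hwp.neg, e, he, hz ▸ hye, r, hrpos, ?_⟩
  rw [← hz, eq_add_of_sub_eq' hr, toReal_neg, smul_neg, add_neg_cancel_right]
  exact hve

end Polytopes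

/-! ### The vertex system of a smooth lattice polytope -/

section VertexStars

variable {P : Set (Fin 3 → ℝ)}

/-- `v` is a vertex of `P`, and `w₁, w₂, w₃` are its primitive edge vectors and form a lattice
basis. -/
def IsVertexStar (P : Set (Fin 3 → ℝ)) (v w₁ w₂ w₃ : Fin 3 → ℤ) : Prop :=
  toReal v ∈ P.extremePoints ℝ ∧ ∃ B : Module.Basis (Fin 3) ℤ (Fin 3 → ℤ),
    Set.range B = primitiveEdgeVectors P (toReal v) ∧ B 0 = w₁ ∧ B 1 = w₂ ∧ B 2 = w₃


theorem IsVertexStar.perm {v : Fin 3 → ℤ} {w : Fin 3 → Fin 3 → ℤ}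
    (h : IsVertexStar P v (w 0) (w 1) (w 2)) (σ : Equiv.Perm (Fin 3)) :
    IsVertexStar P v (w (σ 0)) (w (σ 1)) (w (σ 2)) := by
  obtain ⟨hv, B, hB, h0, h1, h2⟩ := h
  have hw : ∀ i, B i = w i := by
    intro i
    fin_cases i
    exacts [h0, h1, h2]
  refine ⟨hv, B.reindex σ.symm, ?_, ?_, ?_, ?_⟩
  · rw [Module.Basis.range_reindex, hB]
  all_goals simp [hw]

/-- At a vertex of a smooth polytope, any primitive edge vector can be listed first. -/
theorem exists_vertexStar (hsmooth : IsSmoothPolytope P) {v w : Fin 3 → ℤ}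
    (hv : toReal v ∈ P.extremePoints ℝ) (hw : w ∈ primitiveEdgeVectors P (toReal v)) :
    ∃ p q, IsVertexStar P v w p q := by
  obtain ⟨B, hB⟩ := hsmooth.unimodular _ hv
  obtain ⟨i, rfl⟩ := hB ▸ hw
  have h : IsVertexStar P v (B 0) (B 1) (B 2) := ⟨hv, B, hB, rfl, rfl, rfl⟩
  have := h.perm (Equiv.swap 0 i)
  rw [Equiv.swap_apply_left] at this
  exact ⟨_, _, this⟩

theorem coord_vertex_le (hlattice : IsLatticePolytope P) {v : Fin 3 → ℤ}
    (hv : toReal v ∈ P.extremePoints ℝ) {B : Module.Basis (Fin 3) ℤ (Fin 3 → ℤ)}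
    (hB : Set.range B = primitiveEdgeVectors P (toReal v)) {x : Fin 3 → ℝ} (hx : x ∈ P)
    (i : Fin 3) :
    toReal (coordVector (B.coord i)) ⬝ᵥ toReal v ≤ toReal (coordVector (B.coord i)) ⬝ᵥ x := by
  refine hlattice.le_of_edgeVectors (f := dotFunctional (toReal (coordVector (B.coord i)))) hv ?_ hx
  intro w hw
  obtain ⟨j, rfl⟩ := hB ▸ hw
  rw [dotFunctional_apply, toReal_dotProduct, coordVector_dotProduct]
  simp only [Module.Basis.coord_apply, Module.Basis.repr_self, Finsupp.single_apply]
  split_ifs <;> simp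

theorem isVertexSystem (hlattice : IsLatticePolytope P) (hsmooth : IsSmoothPolytope P)
    (h0 : (0 : Fin 3 → ℝ) ∈ interior P) :
    IsVertexSystem {z | toReal z ∈ P} 0 (IsVertexStar P) where
  convex := by
    intro x y z p a b c hx hy hz ha hb hc habc he
    have ha' : (0 : ℝ) ≤ a := by exact_mod_cast ha
    have hb' : (0 : ℝ) ≤ b := by exact_mod_cast hb
    have hc' : (0 : ℝ) ≤ c := by exact_mod_cast hc
    have hs : (0 : ℝ) < a + b + c := by exact_mod_cast habc
    have he' : toReal p = (a / (a + b + c) : ℝ) • toReal x + (b / (a + b + c) : ℝ) • toReal y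
        + (c / (a + b + c) : ℝ) • toReal z := by
      have h1 := congrArg toReal he
      simp only [toReal_add, toReal_smul] at h1
      push_cast at h1
      have h2 : toReal p = ((a + b + c : ℝ)⁻¹) • ((a + b + c : ℝ) • toReal p) := by
        rw [inv_smul_smul₀ hs.ne']
      rw [h2, h1]
      module
    have hconv := hlattice.1.convex
    change toReal p ∈ P
    have hmem := hconv.sum_mem (t := Finset.univ) (w := ![(a / (a + b + c) : ℝ), b / (a + b + c),
      c / (a + b + c)]) (z := ![toReal x, toReal y, toReal z])
      (by intro i _; fin_cases i <;> simp <;> positivity)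
      (by simp [Fin.sum_univ_three]; field_simp)
      (by intro i _; fin_cases i <;> assumption)
    rw [he']
    simpa [Fin.sum_univ_three] using hmem
  interior := by
    intro f hf
    by_contra! hcon
    have hu : coordVector f ≠ 0 := by
      intro hu
      refine hf (LinearMap.ext fun z => ?_)
      rw [← coordVector_dotProduct, hu]
      simp
    set u := toReal (coordVector f) with hudef
    have hu' : u ≠ 0 := by
      rw [hudef, ← toReal_zero]
      exact fun h => hu (toReal_injective h)
    have hle : ∀ y ∈ P, u ⬝ᵥ y ≤ 0 := by
      intro y hy
      have := hlattice.1.le_of_extremePoints (f := -dotFunctional u) (c := 0) (fun s hs => ?_) hy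
      · simpa using this
      obtain ⟨z, rfl⟩ := hlattice.2 s hs
      have h1 := hcon z (show toReal z ∈ P from extremePoints_subset hs)
      rw [map_zero, ← coordVector_dotProduct] at h1
      have h2 : u ⬝ᵥ toReal z ≤ 0 := by
        rw [hudef, toReal_dotProduct]
        exact_mod_cast h1
      simpa using h2
    have hev : ∀ᶠ t : ℝ in nhdsWithin 0 (Set.Ioi 0), t • u ∈ P := by
      have hc : Filter.Tendsto (fun t : ℝ => t • u) (nhds 0) (nhds 0) := by
        have : Continuous fun t : ℝ => t • u := by fun_prop
        simpa using this.tendsto 0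
      exact (hc.eventually (mem_interior_iff_mem_nhds.mp h0)).filter_mono nhdsWithin_le_nhds
    obtain ⟨t, htP, ht⟩ := (hev.and self_mem_nhdsWithin).exists
    have h1 := hle _ htP
    rw [dotProduct_smul, smul_eq_mul] at h1
    have h2 : 0 < u ⬝ᵥ u := lt_of_le_of_ne (Finset.sum_nonneg fun i _ => mul_self_nonneg _)
        (Ne.symm (mt dotProduct_self_eq_zero.mp hu'))
    have := mul_pos (Set.mem_Ioi.mp ht) h2
    linarith
  swap := by
    intro v w₁ w₂ w₃ h
    exact IsVertexStar.perm (w := ![w₁, w₂, w₃]) h (Equiv.swap 0 1)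
  rotate := by
    intro v w₁ w₂ w₃ h
    exact IsVertexStar.perm (w := ![w₁, w₂, w₃]) h (finRotate 3)
  basis := by
    rintro v w₁ w₂ w₃ ⟨-, B, -, hB⟩
    exact ⟨B, hB⟩
  vertex_mem := fun h => show toReal _ ∈ P from extremePoints_subset h.1
  cone := by
    rintro v w₁ w₂ w₃ x ⟨hv, B, hB, rfl, rfl, rfl⟩ hx
    have key : ∀ i, 0 ≤ B.repr (x - v) i := by
      intro i
      have := coord_vertex_le hlattice hv hB hx i
      rw [toReal_dotProduct, toReal_dotProduct, coordVector_dotProduct,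
        coordVector_dotProduct] at this
      have : B.repr v i ≤ B.repr x i := by exact_mod_cast this
      simpa using this
    refine ⟨_, _, _, key 0, key 1, key 2, ?_⟩
    rw [add_assoc, add_assoc, ← sub_eq_iff_eq_add']
    conv_lhs => rw [← B.sum_repr (x - v), Fin.sum_univ_three]
    rw [add_assoc]
  edge := by
    rintro v w₁ w₂ w₃ ⟨hv, B, hB, rfl, rfl, rfl⟩
    obtain ⟨t, ht, hvt, hw⟩ := hlattice.exists_opposite_vertex (hB ▸ Set.mem_range_self 0)
    obtain ⟨p, q, hs⟩ := exists_vertexStar hsmooth hvt hw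
    exact ⟨t, p, q, ht, hs⟩

/-- The coordinate functionals of the basis of edge vectors at a vertex `v` cut out the facets
through `v`. -/
theorem isFacetInequality_coord (hlattice : IsLatticePolytope P) (hsmooth : IsSmoothPolytope P)
    (h0 : (0 : Fin 3 → ℝ) ∈ interior P) {v : Fin 3 → ℤ}
    (hv : toReal v ∈ P.extremePoints ℝ) {B : Module.Basis (Fin 3) ℤ (Fin 3 → ℤ)}
    (hB : Set.range B = primitiveEdgeVectors P (toReal v)) (i : Fin 3) :
    IsFacetInequality P
      {x ∈ P | toReal (-coordVector (B.coord i)) ⬝ᵥ x = ((-B.repr v i : ℤ) : ℝ)}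
      (-coordVector (B.coord i)) ((-B.repr v i : ℤ) : ℝ) := by
  set u := -coordVector (B.coord i) with hu
  have hdot : ∀ z, u ⬝ᵥ z = -B.repr z i := by
    intro z
    rw [hu, neg_dotProduct, coordVector_dotProduct, Module.Basis.coord_apply]
  have hdotB : ∀ j, toReal u ⬝ᵥ toReal (B j) = if j = i then -1 else 0 := by
    intro j
    rw [toReal_dotProduct, hdot, Module.Basis.repr_self, Finsupp.single_apply]
    split_ifs <;> simp
  have hle : ∀ x ∈ P, toReal u ⬝ᵥ x ≤ ((-B.repr v i : ℤ) : ℝ) := by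
    intro x hx
    have := coord_vertex_le hlattice hv hB hx i
    rw [toReal_dotProduct, coordVector_dotProduct] at this
    rw [hu, toReal_neg, neg_dotProduct, Int.cast_neg]
    exact neg_le_neg this
  set F := {x ∈ P | toReal u ⬝ᵥ x = ((-B.repr v i : ℤ) : ℝ)}
  have hvF : toReal v ∈ F := ⟨extremePoints_subset hv, by rw [toReal_dotProduct, hdot]⟩
  have hBF : ∀ j, j ≠ i → toReal (v + B j) ∈ F := by
    intro j hj
    obtain ⟨p, q, hs⟩ := exists_vertexStar hsmooth hv (hB ▸ Set.mem_range_self j)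
    refine ⟨(isVertexSystem hlattice hsmooth h0).add_edge_mem hs, ?_⟩
    rw [toReal_dotProduct, hdot, map_add, Module.Basis.repr_self]
    simp [hj]
  have hBv : ∀ j, j ≠ i → toReal (B j) ∈ vectorSpan ℝ F := by
    intro j hj
    have := vsub_mem_vectorSpan ℝ (hBF j hj) hvF
    rwa [vsub_eq_sub, ← toReal_sub, add_sub_cancel_left] at this
  refine ⟨⟨2, rfl, ⟨_, hvF⟩, fun _ => ⟨dotFunctional (toReal u), ?_⟩, ?_⟩, ?_, hle, rfl⟩
  · ext x
    refine ⟨fun hx => ⟨hx.1, fun y hy => ?_⟩, fun hx => ⟨hx.1, le_antisymm (hle x hx.1) ?_⟩⟩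
    · exact (hle y hy).trans hx.2.ge
    · have := hx.2 _ hvF.1
      rw [dotFunctional_apply, hvF.2] at this
      exact this
  · refine le_antisymm ?_ ?_
    · -- The directions of the face lie in the kernel of a nonzero functional.
      have hker : vectorSpan ℝ F ≤ LinearMap.ker (dotFunctional (toReal u)).toLinearMap := by
        rw [vectorSpan_def, Submodule.span_le]
        rintro _ ⟨x, hx, y, hy, rfl⟩
        simp [dotProduct_sub, hx.2, hy.2]
      have hne : (dotFunctional (toReal u)).toLinearMap ≠ 0 := by
        intro hzero
        have := LinearMap.congr_fun hzero (toReal (B i))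
        simp [hdotB] at this
      have h1 := Module.Dual.finrank_ker_add_one_of_ne_zero hne
      have h2 := Submodule.finrank_mono hker
      rw [Module.finrank_fin_fun] at h1
      rw [polyDim]
      lia
    · obtain ⟨j, k, hj, hk, hjk⟩ : ∃ j k : Fin 3, j ≠ i ∧ k ≠ i ∧ j ≠ k :=
        (by decide : ∀ i : Fin 3, ∃ j k : Fin 3, j ≠ i ∧ k ≠ i ∧ j ≠ k) i
      have hli : LinearIndependent ℝ
          (![⟨_, hBv j hj⟩, ⟨_, hBv k hk⟩] : Fin 2 → vectorSpan ℝ F) := by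
        rw [LinearIndependent.pair_iff]
        intro s t hst
        have hst' : s • toReal (B j) + t • toReal (B k) = 0 := congrArg Subtype.val hst
        have hdual : ∀ l, toReal (coordVector (B.coord l)) ⬝ᵥ (s • toReal (B j) + t • toReal (B k))
            = s * (B.repr (B j) l : ℤ) + t * (B.repr (B k) l : ℤ) := by
          intro l
          simp only [dotProduct_add, dotProduct_smul, toReal_dotProduct, coordVector_dotProduct,
            Module.Basis.coord_apply, smul_eq_mul]
        have hdj := hdual j
        have hdk := hdual k
        rw [hst', dotProduct_zero, Module.Basis.repr_self, Module.Basis.repr_self] at hdj hdk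
        simp only [Finsupp.single_apply, if_true, if_neg hjk, if_neg hjk.symm] at hdj hdk
        constructor
        · simpa using hdj.symm
        · simpa using hdk.symm
      simpa [polyDim] using hli.fintype_card_le_finrank
  · refine isPrimitiveVector_of_dotProduct_eq_one (w := -B i) ?_
    rw [dotProduct_neg, hdot]
    simp

theorem exists_edgeVector (hsmooth : IsSmoothPolytope P) {e : Set (Fin 3 → ℝ)} (he : IsEdge P e)
    {v : Fin 3 → ℝ} (hve : v ∈ e) :
    ∃ w ∈ primitiveEdgeVectors P v, toReal w ∈ vectorSpan ℝ e := by
  obtain ⟨d, hd0, hd⟩ := hsmooth.rational e he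
  obtain ⟨w, g, hw, hg, rfl⟩ := exists_primitive hd0
  have hg' : (g : ℝ) ≠ 0 := by exact_mod_cast hg.ne'
  have hwe : toReal w ∈ vectorSpan ℝ e := by
    have := Submodule.smul_mem _ (g : ℝ)⁻¹ hd
    rwa [toReal_smul, inv_smul_smul₀ hg'] at this
  have hw0 : toReal w ≠ 0 := by
    rw [← toReal_zero]
    exact fun h => hw.ne_zero (toReal_injective h)
  obtain ⟨y, hy, hne⟩ : ∃ y ∈ e, y ≠ v := by
    by_contra! hcon
    have h1 : vectorSpan ℝ e = ⊥ := vectorSpan_of_subsingleton ℝ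
      fun x hx y hy => (hcon x hx).trans (hcon y hy).symm
    have h2 : Module.finrank ℝ (vectorSpan ℝ e) = 1 := he.2.2
    rw [h1, finrank_bot] at h2
    exact zero_ne_one h2
  obtain ⟨r, hr⟩ := he.mem_span_of_mem hwe hw0 hve hy
  rcases lt_trichotomy r 0 with h | rfl | h
  · refine ⟨-w, ⟨hw.neg, e, he, hve, -r, neg_pos.mpr h, ?_⟩, ?_⟩
    · rw [toReal_neg, neg_smul_neg, ← hr, add_sub_cancel]
      exact hy
    · rw [toReal_neg]
      exact Submodule.neg_mem _ hwe
  · rw [zero_smul, sub_eq_zero] at hr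
    exact absurd hr hne
  · refine ⟨w, ⟨hw, e, he, hve, r, h, ?_⟩, hwe⟩
    rw [← hr, add_sub_cancel]
    exact hy

end VertexStars

theorem proposition7 (P : Set (Fin 3 → ℝ)) (hlattice : IsLatticePolytope P)
    (hsmooth : IsSmoothPolytope P) (h0 : (0 : Fin 3 → ℝ) ∈ interior P)
    (e : Set (Fin 3 → ℝ)) (he : IsEdge P e) (hnext : IsNextTo P e 0) :
    ∃ B : Module.Basis (Fin 3) ℤ (Fin 3 → ℤ), ∀ i, B i ∈ ewaldSet P := by
  obtain ⟨v', hv'⟩ := (he.2.1.isCompact hlattice.1.isCompact).extremePoints_nonempty he.1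
  have hv := he.2.1.isExtreme.extremePoints_subset_extremePoints hv'
  obtain ⟨v, rfl⟩ := hlattice.2 _ hv
  have hve := extremePoints_subset hv'
  obtain ⟨w, hw, hwe⟩ := exists_edgeVector hsmooth he hve
  have hsys := isVertexSystem hlattice hsmooth h0
  obtain ⟨p, q, hs⟩ := exists_vertexStar hsmooth hv hw
  have hs' := hsys.rotate hs
  obtain ⟨-, B, hB, rfl, rfl, rfl⟩ := id hs'
  have hw0 : toReal (B 2) ≠ 0 := by
    rw [← toReal_zero]
    exact fun h => hw.1.ne_zero (toReal_injective h)
  -- The two facets through `e` are at distance at most one from the origin by hypothesis, and at a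
  -- positive integral distance since `v` is a lattice point and the origin is interior.
  have key : ∀ i, i ≠ 2 → B.repr (-v) i = 1 := by
    intro i hi
    have hfacet := isFacetInequality_coord hlattice hsmooth h0 hv hB i
    have hle : |((-B.repr v i : ℤ) : ℝ) - toReal (-coordVector (B.coord i)) ⬝ᵥ 0| ≤ 1 := by
      refine hnext.2.2 ⟨_, _, _, hfacet, ?_, rfl⟩
      intro x hx
      refine ⟨he.2.1.subset hx, ?_⟩
      obtain ⟨r, hr⟩ := he.mem_span_of_mem hwe hw0 hve hx
      rw [eq_add_of_sub_eq' hr, dotProduct_add, dotProduct_smul, toReal_dotProduct,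
        toReal_dotProduct, neg_dotProduct, neg_dotProduct, coordVector_dotProduct,
        coordVector_dotProduct]
      simp [hi.symm]
    have hne : -B.coord i ≠ 0 := by
      intro hzero
      have := LinearMap.congr_fun hzero (B i)
      simp at this
    obtain ⟨x, hx, hlt⟩ := hsys.interior _ hne
    have h1 := hfacet.2.2.1 _ hx
    rw [toReal_dotProduct, neg_dotProduct, coordVector_dotProduct] at h1
    have h1' : -B.repr x i ≤ -B.repr v i := by exact_mod_cast h1
    have hlt' : 0 < -B.repr x i := by simpa using hlt
    rw [dotProduct_zero, sub_zero, abs_le] at hle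
    have h2 : -B.repr v i ≤ 1 := by exact_mod_cast hle.2
    rw [map_neg, Finsupp.neg_apply]
    lia
  have ho : (0 : Fin 3 → ℤ) = v + B 0 + B 1 + (B.repr (-v) 2) • B 2 := by
    have h1 := B.sum_repr (-v)
    rw [Fin.sum_univ_three, key 0 (by decide), key 1 (by decide)] at h1
    rw [one_smul, one_smul] at h1
    rw [add_assoc, add_assoc, ← add_assoc (B 0), h1, add_neg_cancel]
  obtain ⟨C, hC⟩ := hsys.exists_basis hs' ho (by
    change toReal 0 ∈ P
    rw [toReal_zero]
    exact interior_subset h0)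
  refine ⟨C, fun i => ?_⟩
  have h1 : toReal (0 + C i) ∈ P := (hC i).1
  have h2 : toReal (0 - C i) ∈ P := (hC i).2
  rw [zero_add] at h1
  rw [zero_sub, toReal_neg] at h2
  exact ⟨h1, h2⟩
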